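/- Let $T>0$, $\alpha>0$, $N,n\in\mathbb N$, let $\omega_{\mathrm{obs}}\subset\Omega\subset\mathbb R^n$ be measurable, let $U:=L^2(0,T;\mathbb R^N)$ (with the Euclidean norm on $\mathbb R^N$, and $U$ identified with its dual), let $S:U\to L^2((0,T)\times\Omega)$ be a continuous affine operator (for instance the solution operator $u\mapsto y$ of a well-posed linear parabolic equation $\partial_t y-Ay=\sum_{i=1}^N\chi_{\omega_i}u_i$, $y(0)=y_0$, with $\omega_i\subset\Omega$ and suitable boundary conditions), and let $y^d\in L^2(0,T;L^2(\omega_{\mathrm{obs}}))$. For $u\in U$ put $$\mathcal F(u)=\tfrac12\|Su-y^d\|^2_{L^2(0,T;L^2(\omega_{\mathrm{obs}}))},\qquad \mathcal G(u)=\tfrac\alpha2\int_0^T\Big(\sum_{j=1}^N|u_j(t)|\Big)^2dt .$$ Let $\mathcal G^*(p)=\sup_{u\in U}\big(\langle p,u\rangle-\mathcal G(u)\big)$ be the Fenchel conjugate of $\mathcal G$ and, for $\gamma>0$, $$\mathrm{prox}_{\gamma\mathcal G^*}(v)=\operatorname*{arg\,min}_{w\in U}\Big(\tfrac1{2\gamma}\|w-v\|_U^2+\mathcal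 G^*(w)\Big),\qquad (\partial\mathcal G^*)_\gamma(p)=\tfrac1\gamma\big(p-\mathrm{prox}_{\gamma\mathcal G^*}(p)\big).$$ Then for each $\gamma>0$ the mapping $\mathrm{prox}_{\gamma\mathcal G^*}$ is well defined and single-valued on $U$, and the regularized system $$-p_\gamma=\mathcal F'(u_\gamma),\qquad u_\gamma=(\partial\mathcal G^*)_\gamma(p_\gamma)$$ has a unique solution $(u_\gamma,p_\gamma)\in U\times U$. Moreover, it is the optimality system of the problem $\min_{u\in U}\mathcal F(u)+\mathcal G(u)+\frac\gamma2\|u\|_U^2$: the objective is strictly convex, and $u\in U$ is a minimizer if and only if there is a $p\in U$ such that $(u,p)$ solves the regularized system. -/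

import Mathlib

open MeasureTheory Set

noncomputable section

namespace SwitchingControl

section ConvexAnalysis

variable {E : Type*} [NormedAddCommGroup E] [InnerProductSpace ℝ E]

/-- Fenchel conjugate `H*(p) = sup_u (⟪p, u⟫ - H(u))` of an extended real valued function. -/
def fenchelConj (H : E → EReal) (p : E) : EReal :=
  ⨆ u : E, (((inner ℝ p u : ℝ) : EReal) - H u)

/-- The proximal mapping `prox_{γH}(v)`, as the set of all minimizers `w` of
`‖w - v‖² / (2γ) + H(w)`. -/
def prox (γ : ℝ) (H : E → EReal) (v : E) : Set E :=
  {w | IsMinOn (fun x : E => ((1 / (2 * γ) * ‖x - v‖ ^ 2 : ℝ) : EReal) + H x) univ w}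

/-- The Moreau–Yosida regularization `(∂H)_γ(p) = (p - prox_{γH}(p)) / γ`, as a set
(it has one element as soon as `prox_{γH}(p)` has exactly one). -/
def moreauYosida (γ : ℝ) (H : E → EReal) (p : E) : Set E :=
  {u | ∃ w ∈ prox γ H p, u = (1 / γ) • (p - w)}

end ConvexAnalysis

/-- The control space `L²(0,T;ℝᴺ)`, where `ℝᴺ` carries the Euclidean norm. -/
abbrev Control (N : ℕ) (T : ℝ) : Type :=
  Lp (EuclideanSpace ℝ (Fin N)) 2 (volume.restrict (Ioo (0 : ℝ) T))

/-- `L²((0,T) × D)`, identified with `L²(0,T;L²(D))`, for `D ⊆ ℝⁿ`. -/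
abbrev SpaceTimeL2 {n : ℕ} (T : ℝ) (D : Set (EuclideanSpace ℝ (Fin n))) : Type :=
  Lp ℝ 2 ((volume : Measure (ℝ × EuclideanSpace ℝ (Fin n))).restrict (Ioo (0 : ℝ) T ×ˢ D))

/-- Tracking term `F(u) = 1/2 ‖Su - y^d‖²` in `L²(0,T;L²(ω_obs))`. -/
def tracking {n N : ℕ} {T : ℝ} {Ω ωobs : Set (EuclideanSpace ℝ (Fin n))}
    (S : Control N T →ᴬ[ℝ] SpaceTimeL2 T Ω) (yd : SpaceTimeL2 T ωobs) (u : Control N T) : ℝ :=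
  1 / 2 * ∫ z in Ioo (0 : ℝ) T ×ˢ ωobs, (S u z - yd z) ^ 2

/-- Switching cost `G(u) = α/2 ∫₀ᵀ |u(t)|₁² dt` with the `ℓ¹` norm `|v|₁ = ∑ⱼ |vⱼ|`. -/
def switchingCost {N : ℕ} {T : ℝ} (α : ℝ) (u : Control N T) : ℝ :=
  α / 2 * ∫ t in Ioo (0 : ℝ) T, (∑ j, |u t j|) ^ 2

/-- The conjugate `G*` of the switching cost, on `L²(0,T;ℝᴺ)` identified with its dual. -/
def switchingConj {N : ℕ} {T : ℝ} (α : ℝ) : Control N T → EReal :=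
  fenchelConj (fun u => (switchingCost α u : EReal))

/-- The regularized system `-p = F'(u)`, `u = (∂G*)_γ(p)`; `F'(u)` is the Fréchet derivative,
represented by an element of `L²(0,T;ℝᴺ)`. -/
def SolvesRegularizedSystem {n N : ℕ} {T : ℝ} {Ω ωobs : Set (EuclideanSpace ℝ (Fin n))}
    (S : Control N T →ᴬ[ℝ] SpaceTimeL2 T Ω) (yd : SpaceTimeL2 T ωobs) (α γ : ℝ)
    (u p : Control N T) : Prop :=
  HasGradientAt (tracking S yd) (-p) u ∧ u ∈ moreauYosida γ (switchingConj α) p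

/-- The regularized objective `F(u) + G(u) + γ/2 ‖u‖²`. -/
def regularizedObjective {n N : ℕ} {T : ℝ} {Ω ωobs : Set (EuclideanSpace ℝ (Fin n))}
    (S : Control N T →ᴬ[ℝ] SpaceTimeL2 T Ω) (yd : SpaceTimeL2 T ωobs) (α γ : ℝ)
    (u : Control N T) : ℝ :=
  tracking S yd u + switchingCost α u + γ / 2 * ‖u‖ ^ 2

end SwitchingControl

end

open MeasureTheory Set Filter Topology

/-! No formula for `G*` is needed. By the Fenchel–Young equality, `u ∈ (∂G*)_γ(p)` says that `p -
γu` is a subgradient of `G` at `u`, that is, `u` minimizes `G + γ/2 ‖·‖² - ⟪p, ·⟫`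
(`mem_moreauYosida_fenchelConj_iff`). When `-p = F'(u)`, convexity lets the linear term be exchanged
for `F` (`isMinOn_add_iff`), so the system says that `u` minimizes the regularized objective. That
objective is continuous, nonnegative and strongly convex, hence has exactly one minimizer `u`, and
`p = -F'(u)` is then determined. -/

namespace SwitchingControl

/-! ### Convex analysis on a real Hilbert space. -/

section Hilbert

variable {E : Type*} [NormedAddCommGroup E] [InnerProductSpace ℝ E]

/-- A continuous strongly convex function on a Hilbert space that is bounded below attains its
minimum: minimizing sequences are Cauchy. -/
lemma exists_isMinOn_of_strongConvexOn [CompleteSpace E] {f : E → ℝ} {m : ℝ} (hm : 0 < m)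
    (hf : StrongConvexOn univ m f) (hc : Continuous f) (hb : BddBelow (range f)) :
    ∃ u, IsMinOn f univ u := by
  have hlow : ∀ x, sInf (range f) ≤ f x := fun x => csInf_le hb (mem_range_self x)
  have hseq : ∀ k : ℕ, ∃ x, f x < sInf (range f) + 1 / ((k : ℝ) + 1) := fun k => by
    obtain ⟨_, ⟨x, rfl⟩, hx⟩ := exists_lt_of_csInf_lt (range_nonempty f)
      (lt_add_of_pos_right (sInf (range f)) (Nat.one_div_pos_of_nat (α := ℝ) (n := k)))
    exact ⟨x, hx⟩
  choose u hu using hseq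
  have hdist : ∀ i j k : ℕ, k ≤ i → k ≤ j →
      dist (u i) (u j) ≤ Real.sqrt (8 / m * (1 / ((k : ℝ) + 1))) := by
    intro i j k hi hj
    apply Real.le_sqrt_of_sq_le
    -- At the midpoint the strong convexity gain is `m/8 * ‖u i - u j‖ ^ 2`, whence the constant `8
    -- / m`.
    have h := hf.2 (mem_univ (u i)) (mem_univ (u j)) (by norm_num : (0 : ℝ) ≤ 1 / 2)
      (by norm_num : (0 : ℝ) ≤ 1 / 2) (by norm_num)
    have h1 := (hu i).le.trans (add_le_add_right (Nat.one_div_le_one_div (α := ℝ) hi) _)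
    have h2 := (hu j).le.trans (add_le_add_right (Nat.one_div_le_one_div (α := ℝ) hj) _)
    have h3 := hlow ((1 / 2 : ℝ) • u i + (1 / 2 : ℝ) • u j)
    simp only [smul_eq_mul] at h
    rw [dist_eq_norm, div_mul_eq_mul_div, le_div_iff₀ hm]
    nlinarith
  have hlim : Tendsto (fun k : ℕ => Real.sqrt (8 / m * (1 / ((k : ℝ) + 1)))) atTop (𝓝 0) := by
    have h := (tendsto_one_div_add_atTop_nhds_zero_nat (𝕜 := ℝ)).const_mul (8 / m)
    simpa using h.sqrt
  obtain ⟨a, ha⟩ := cauchySeq_tendsto_of_complete (cauchySeq_of_le_tendsto_0 _ hdist hlim)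
  refine ⟨a, isMinOn_univ_iff.2 fun x => le_trans ?_ (hlow x)⟩
  have hr := (tendsto_one_div_add_atTop_nhds_zero_nat (𝕜 := ℝ)).const_add (sInf (range f))
  rw [add_zero] at hr
  exact le_of_tendsto_of_tendsto' ((hc.tendsto a).comp ha) hr fun k => (hu k).le

/-- Linear growth along a segment bounds the directional derivative from below. -/
lemma le_inner_of_hasGradientAt [CompleteSpace E] {F : E → ℝ} {g u x : E} {c : ℝ}
    (hF : HasGradientAt F g u)
    (hc : ∀ t : ℝ, 0 < t → t ≤ 1 → F u + t * c ≤ F (u + t • (x - u))) :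
    c ≤ inner ℝ g (x - u) := by
  have hline : HasDerivAt (fun t : ℝ => F (u + t • (x - u))) (inner ℝ g (x - u)) 0 := by
    have h1 : HasDerivAt (fun t : ℝ => u + t • (x - u)) (x - u) 0 := by
      simpa using ((hasDerivAt_id (0 : ℝ)).smul_const (x - u)).const_add u
    have h2 : HasFDerivAt F (InnerProductSpace.toDual ℝ E g) (u + (0 : ℝ) • (x - u)) := by
      simpa using hF.hasFDerivAt
    exact h2.comp_hasDerivAt (0 : ℝ) h1
  refine ge_of_tendsto hline.tendsto_slope_zero_right ?_
  filter_upwards [Ioc_mem_nhdsGT (zero_lt_one' ℝ)] with t ht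
  have h := hc t ht.1 ht.2
  simp only [zero_add, zero_smul, add_zero, smul_eq_mul]
  rw [inv_mul_eq_div, le_div_iff₀ ht.1]
  linarith

/-- The first order condition `-F'(u) ∈ ∂H(u)` at a minimizer `u` of `F + H`. -/
lemma subgradient_of_isMinOn_add [CompleteSpace E] {F H : E → ℝ} {g u : E}
    (hF : HasGradientAt F g u) (hH : ConvexOn ℝ univ H)
    (hmin : IsMinOn (fun x => F x + H x) univ u) (x : E) :
    H u ≤ H x + inner ℝ g (x - u) := by
  have := le_inner_of_hasGradientAt (x := x) (c := H u - H x) hF fun t ht0 ht1 => by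
    have h1 := isMinOn_univ_iff.1 hmin (u + t • (x - u))
    have h2 := hH.2 (mem_univ u) (mem_univ x) (sub_nonneg.2 ht1) ht0.le (by ring)
    have h3 : (1 - t) • u + t • x = u + t • (x - u) := by module
    rw [h3] at h2
    simp only [smul_eq_mul] at h2
    linarith
  linarith

/-- A differentiable convex function lies above its tangents. -/
lemma add_inner_le_of_convexOn [CompleteSpace E] {F : E → ℝ} {g u : E}
    (hF : HasGradientAt F g u) (hc : ConvexOn ℝ univ F) (x : E) :
    F u + inner ℝ g (x - u) ≤ F x := by
  have hneg : HasGradientAt (fun y => -F y) (-g) u := by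
    rw [hasGradientAt_iff_hasFDerivAt, map_neg]
    exact hF.hasFDerivAt.neg
  -- Every point minimizes `-F + F = 0`.
  have := subgradient_of_isMinOn_add hneg hc
    (isMinOn_univ_iff.2 fun y => by simp) x
  rw [inner_neg_left] at this
  linarith

/-- Both sides say that `p` is a subgradient of `H` at `u`: forward by the first order condition,
backward because `F` lies above its tangent at `u`. -/
lemma isMinOn_add_iff [CompleteSpace E] {F H : E → ℝ} {p u : E}
    (hF : HasGradientAt F (-p) u) (hFc : ConvexOn ℝ univ F) (hH : ConvexOn ℝ univ H) :
    IsMinOn (fun x => F x + H x) univ u ↔ IsMinOn (fun x => H x - inner ℝ p x) univ u := by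
  constructor <;> intro h <;> refine isMinOn_univ_iff.2 fun x => ?_
  · have := subgradient_of_isMinOn_add hF hH h x
    rw [inner_neg_left, inner_sub_right] at this
    linarith
  · have h1 := add_inner_le_of_convexOn hF hFc x
    have h2 := isMinOn_univ_iff.1 h x
    rw [inner_neg_left, inner_sub_right] at h1
    linarith

/-- The Fenchel–Young equality at a subgradient. -/
lemma fenchelConj_eq_of_subgradient {G : E → ℝ} {w u : E}
    (h : ∀ x, G u + inner ℝ w (x - u) ≤ G x) :
    fenchelConj (fun x => (G x : EReal)) w = ((inner ℝ w u - G u : ℝ) : EReal) := by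
  refine le_antisymm (iSup_le fun x => ?_) ?_
  · rw [← EReal.coe_sub, EReal.coe_le_coe_iff]
    have := h x
    rw [inner_sub_right] at this
    linarith
  · rw [EReal.coe_sub]
    exact le_iSup (fun x => ((inner ℝ w x : ℝ) : EReal) - (G x : EReal)) u

/-- Testing the supremum in `G*(x)` with the single point `u` bounds the prox objective below by its
value at `w` plus `‖x - w‖ ^ 2 / (2γ)`. This gives minimality and uniqueness at once, even where
`G*` is infinite. -/
lemma prox_fenchelConj_eq_singleton {G : E → ℝ} {γ : ℝ} (hγ : 0 < γ) {w u p : E}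
    (h : ∀ x, G u + inner ℝ w (x - u) ≤ G x) (hp : w = p - γ • u) :
    prox γ (fenchelConj fun x => (G x : EReal)) p = {w} := by
  have key : ∀ x : E,
      ((1 / (2 * γ) * ‖w - p‖ ^ 2 + (inner ℝ w u - G u) + 1 / (2 * γ) * ‖x - w‖ ^ 2 : ℝ) : EReal)
        ≤ ((1 / (2 * γ) * ‖x - p‖ ^ 2 : ℝ) : EReal)
          + fenchelConj (fun x => (G x : EReal)) x := by
    intro x
    refine le_trans ?_ (add_le_add_right
      (le_iSup (fun y => ((inner ℝ x y : ℝ) : EReal) - (G y : EReal)) u) _)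
    rw [← EReal.coe_sub, ← EReal.coe_add, EReal.coe_le_coe_iff]
    -- The cross term `-⟪x - w, u⟫` turns `⟪x, u⟫` into `⟪w, u⟫`, so equality holds.
    have h1 : x - p = (x - w) - γ • u := by rw [hp]; abel
    have h2 : w - p = -(γ • u) := by rw [hp]; abel
    rw [h1, h2, norm_sub_sq_real (x - w), norm_neg, real_inner_smul_right, inner_sub_left]
    apply le_of_eq
    field_simp
    ring
  have hval : ((1 / (2 * γ) * ‖w - p‖ ^ 2 : ℝ) : EReal)
      + fenchelConj (fun x => (G x : EReal)) w
      = ((1 / (2 * γ) * ‖w - p‖ ^ 2 + (inner ℝ w u - G u) : ℝ) : EReal) := by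
    rw [fenchelConj_eq_of_subgradient h, ← EReal.coe_add]
  ext x
  simp only [prox, mem_ofPred_eq, mem_singleton_iff, isMinOn_univ_iff]
  constructor
  · intro hx
    have h1 := (key x).trans (hx w)
    rw [hval, EReal.coe_le_coe_iff] at h1
    have h2 : 1 / (2 * γ) * ‖x - w‖ ^ 2 ≤ 0 := by linarith
    have h3 : ‖x - w‖ ^ 2 ≤ 0 := nonpos_of_mul_nonpos_right h2 (by positivity)
    exact sub_eq_zero.1 (norm_eq_zero.1 (pow_eq_zero_iff two_ne_zero |>.1
      (le_antisymm h3 (sq_nonneg _))))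
  · rintro rfl y
    rw [hval]
    refine le_trans ?_ (key y)
    rw [EReal.coe_le_coe_iff]
    have : 0 ≤ 1 / (2 * γ) * ‖y - x‖ ^ 2 := by positivity
    linarith

lemma strongConvexOn_add_norm_sq {H : E → ℝ} {γ : ℝ} (hH : ConvexOn ℝ univ H) :
    StrongConvexOn univ γ (fun x => H x + γ / 2 * ‖x‖ ^ 2) := by
  rw [strongConvexOn_iff_convex]
  simpa using hH

lemma convexOn_sub_inner {H : E → ℝ} (hH : ConvexOn ℝ univ H) (p : E) :
    ConvexOn ℝ univ (fun x => H x - inner ℝ p x) :=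
  hH.sub ((innerSL ℝ p).toLinearMap.concaveOn convex_univ)

lemma hasGradientAt_norm_sq_sub_inner [CompleteSpace E] (γ : ℝ) (p u : E) :
    HasGradientAt (fun x => γ / 2 * ‖x‖ ^ 2 - inner ℝ p x) (-(p - γ • u)) u := by
  rw [hasGradientAt_iff_hasFDerivAt]
  have h := ((hasStrictFDerivAt_norm_sq u).hasFDerivAt.const_mul (γ / 2)).sub
    (innerSL ℝ p).hasFDerivAt
  refine (h.congr_fderiv ?_)
  ext x
  simp
  ring

/-- Minimizers of `G + γ/2 ‖·‖² - ⟪p, ·⟫` yield subgradients of `G`. -/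
lemma subgradient_of_isMinOn_tilted [CompleteSpace E] {G : E → ℝ} {γ : ℝ}
    (hG : ConvexOn ℝ univ G) {p u : E}
    (hu : IsMinOn (fun x => G x + γ / 2 * ‖x‖ ^ 2 - inner ℝ p x) univ u) (x : E) :
    G u + inner ℝ (p - γ • u) (x - u) ≤ G x := by
  have hmin : IsMinOn (fun x => (γ / 2 * ‖x‖ ^ 2 - inner ℝ p x) + G x) univ u :=
    isMinOn_univ_iff.2 fun y => by have := isMinOn_univ_iff.1 hu y; linarith
  have := subgradient_of_isMinOn_add (hasGradientAt_norm_sq_sub_inner γ p u) hG hmin x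
  rw [inner_neg_left] at this
  linarith

lemma exists_isMinOn_tilted [CompleteSpace E] {G : E → ℝ} {γ : ℝ} (hγ : 0 < γ)
    (hG : ConvexOn ℝ univ G) (hGc : Continuous G) (hG0 : ∀ x, 0 ≤ G x) (p : E) :
    ∃ u, IsMinOn (fun x => G x + γ / 2 * ‖x‖ ^ 2 - inner ℝ p x) univ u := by
  have heq : (fun x => G x + γ / 2 * ‖x‖ ^ 2 - inner ℝ p x)
      = fun x => (G x - inner ℝ p x) + γ / 2 * ‖x‖ ^ 2 := by ext x; ring
  rw [heq]
  refine exists_isMinOn_of_strongConvexOn hγ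
    (strongConvexOn_add_norm_sq (convexOn_sub_inner hG p)) (by fun_prop)
    -- The minimum of `γ/2 * r ^ 2 - ‖p‖ * r` over real `r`.
    ⟨-(‖p‖ ^ 2 / (2 * γ)), ?_⟩
  rintro _ ⟨x, rfl⟩
  have h1 := real_inner_le_norm p x
  have h2 : γ / 2 * ‖x‖ ^ 2 - ‖p‖ * ‖x‖ + ‖p‖ ^ 2 / (2 * γ)
      = (γ * ‖x‖ - ‖p‖) ^ 2 / (2 * γ) := by field_simp; ring
  have h3 : 0 ≤ (γ * ‖x‖ - ‖p‖) ^ 2 / (2 * γ) := by positivity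
  have := hG0 x
  show _ ≤ _
  linarith

/-- `(∂G*)_γ(p)` is the set of minimizers of `G + γ/2 ‖·‖² - ⟪p, ·⟫`. -/
lemma mem_moreauYosida_fenchelConj_iff [CompleteSpace E] {G : E → ℝ} {γ : ℝ} (hγ : 0 < γ)
    (hG : ConvexOn ℝ univ G) (hGc : Continuous G) (hG0 : ∀ x, 0 ≤ G x) {p u : E} :
    u ∈ moreauYosida γ (fenchelConj fun x => (G x : EReal)) p ↔
      IsMinOn (fun x => G x + γ / 2 * ‖x‖ ^ 2 - inner ℝ p x) univ u := by
  have cancel : ∀ v : E, (1 / γ) • (p - (p - γ • v)) = v := fun v => by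
    rw [sub_sub_cancel, smul_smul, one_div_mul_cancel hγ.ne', one_smul]
  constructor
  · rintro ⟨w, hw, rfl⟩
    -- A minimizer `v` identifies the unknown prox point `w` as `p - γ • v`.
    obtain ⟨v, hv⟩ := exists_isMinOn_tilted hγ hG hGc hG0 p
    rw [prox_fenchelConj_eq_singleton hγ (subgradient_of_isMinOn_tilted hG hv) rfl] at hw
    rw [mem_singleton_iff.1 hw, cancel]
    exact hv
  · intro hu
    refine ⟨p - γ • u, ?_, (cancel u).symm⟩
    rw [prox_fenchelConj_eq_singleton hγ (subgradient_of_isMinOn_tilted hG hu) rfl]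
    exact mem_singleton _

lemma existsUnique_mem_prox_fenchelConj [CompleteSpace E] {G : E → ℝ} {γ : ℝ} (hγ : 0 < γ)
    (hG : ConvexOn ℝ univ G) (hGc : Continuous G) (hG0 : ∀ x, 0 ≤ G x) (p : E) :
    ∃! w, w ∈ prox γ (fenchelConj fun x => (G x : EReal)) p := by
  obtain ⟨u, hu⟩ := exists_isMinOn_tilted hγ hG hGc hG0 p
  rw [prox_fenchelConj_eq_singleton hγ (subgradient_of_isMinOn_tilted hG hu) rfl]
  exact ⟨_, mem_singleton _, fun _ h => h⟩

/-- The least squares functional `½ ‖A u - y‖²` of a continuous affine map is convex. -/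
lemma convexOn_half_norm_sq_affine {Y : Type*} [NormedAddCommGroup Y] [InnerProductSpace ℝ Y]
    (A : E →ᴬ[ℝ] Y) (y : Y) : ConvexOn ℝ univ (fun u => 1 / 2 * ‖A u - y‖ ^ 2) := by
  have h1 : ConvexOn ℝ univ (fun z : Y => ‖z - y‖) := by
    simpa [Function.comp_def] using (convexOn_norm (convex_univ (𝕜 := ℝ) (E := Y))).comp_affineMap
      (AffineMap.id ℝ Y - AffineMap.const ℝ Y y)
  have h2 := (h1.comp_affineMap (A : E →ᵃ[ℝ] Y)).pow (fun _ _ => norm_nonneg _) 2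
  have h3 := h2.smul (c := (1 / 2 : ℝ)) (by norm_num)
  simpa [Function.comp_def] using h3

lemma differentiable_half_norm_sq_affine {Y : Type*} [NormedAddCommGroup Y]
    [InnerProductSpace ℝ Y] (A : E →ᴬ[ℝ] Y) (y : Y) :
    Differentiable ℝ (fun u => 1 / 2 * ‖A u - y‖ ^ 2) := by
  have hA : Differentiable ℝ A := by
    have : (A : E → Y) = fun u => A.contLinear u + A 0 := by
      ext u
      simpa using A.map_vadd 0 u
    rw [this]
    fun_prop
  exact ((hA.sub_const y).norm_sq ℝ).const_mul _

end Hilbert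

/-! ### The tracking term and the switching cost on `L²`. -/

section Lebesgue

lemma Lp_two_norm_sq {X V : Type*} [MeasurableSpace X] [NormedAddCommGroup V]
    [InnerProductSpace ℝ V] {μ : Measure X} (f : Lp V 2 μ) :
    ‖f‖ ^ 2 = ∫ x, ‖f x‖ ^ 2 ∂μ := by
  rw [← real_inner_self_eq_norm_sq, L2.inner_def]
  simp_rw [real_inner_self_eq_norm_sq]

lemma Lp_two_integrable_norm_sq {X V : Type*} [MeasurableSpace X] [NormedAddCommGroup V]
    {μ : Measure X} (f : Lp V 2 μ) :
    Integrable (fun x => ‖f x‖ ^ 2) μ :=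
  (Lp.memLp f).integrable_norm_pow two_ne_zero

/-- Restriction of `L²` functions to a subset, with the restricted measure given up to equality. -/
lemma exists_Lp_restrict {X : Type*} [MeasurableSpace X] {μ ν : Measure X} {s : Set X}
    (h : ν = μ.restrict s) :
    ∃ R : Lp ℝ 2 μ →L[ℝ] Lp ℝ 2 ν, ∀ f, R f =ᵐ[ν] f := by
  subst h
  exact ⟨LpToLpRestrictCLM X ℝ ℝ μ 2 s, LpToLpRestrictCLM_coeFn ℝ s⟩

variable {n N : ℕ} {T : ℝ} {Ω ωobs : Set (EuclideanSpace ℝ (Fin n))}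

/-- The tracking term is a least squares functional of an affine observation. -/
lemma exists_tracking_eq_half_norm_sq (hω : MeasurableSet ωobs) (hsub : ωobs ⊆ Ω)
    (S : Control N T →ᴬ[ℝ] SpaceTimeL2 T Ω) (yd : SpaceTimeL2 T ωobs) :
    ∃ A : Control N T →ᴬ[ℝ] SpaceTimeL2 T ωobs,
      tracking S yd = fun u => 1 / 2 * ‖A u - yd‖ ^ 2 := by
  obtain ⟨R, hR⟩ := exists_Lp_restrict
    (μ := (volume : Measure (ℝ × EuclideanSpace ℝ (Fin n))).restrict (Ioo (0 : ℝ) T ×ˢ Ω))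
    (ν := (volume : Measure (ℝ × EuclideanSpace ℝ (Fin n))).restrict (Ioo (0 : ℝ) T ×ˢ ωobs))
    (s := Ioo (0 : ℝ) T ×ˢ ωobs) (by
      rw [Measure.restrict_restrict (measurableSet_Ioo.prod hω),
        inter_eq_self_of_subset_left (prod_mono_right hsub)])
  refine ⟨R.toContinuousAffineMap.comp S, funext fun u => ?_⟩
  rw [tracking, Lp_two_norm_sq]
  congr 1
  refine integral_congr_ae ?_
  filter_upwards [hR (S u), Lp.coeFn_sub (R (S u)) yd] with z h1 h2
  show _ = ‖(R (S u) - yd : SpaceTimeL2 T ωobs) z‖ ^ 2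
  rw [h2, Pi.sub_apply, h1, Real.norm_eq_abs, sq_abs]

lemma convexOn_sq_sum_abs :
    ConvexOn ℝ univ (fun v : EuclideanSpace ℝ (Fin N) => (∑ j, |v j|) ^ 2) := by
  refine ConvexOn.pow ⟨convex_univ, fun x _ y _ a b ha hb _ => ?_⟩
    (fun _ _ => Finset.sum_nonneg fun _ _ => abs_nonneg _) 2
  simp only [smul_eq_mul, Finset.mul_sum, ← Finset.sum_add_distrib]
  refine Finset.sum_le_sum fun j _ => ?_
  simpa [abs_mul, abs_of_nonneg ha, abs_of_nonneg hb] using abs_add_le (a * x j) (b * y j)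

/-- Cauchy–Schwarz. This bound makes the integrand of the switching cost integrable for every
control and the cost locally bounded. -/
lemma sq_sum_abs_le (v : EuclideanSpace ℝ (Fin N)) : (∑ j, |v j|) ^ 2 ≤ N * ‖v‖ ^ 2 := by
  rw [EuclideanSpace.norm_sq_eq]
  simpa using sq_sum_le_card_mul_sum_sq (s := Finset.univ) (f := fun j => |v j|)

lemma integrable_sq_sum_abs (u : Control N T) :
    Integrable (fun t => (∑ j, |u t j|) ^ 2) (volume.restrict (Ioo (0 : ℝ) T)) := by
  refine ((Lp_two_integrable_norm_sq u).const_mul (N : ℝ)).mono' ?_ (ae_of_all _ fun t => ?_)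
  · have hc : Continuous (fun v : EuclideanSpace ℝ (Fin N) => (∑ j, |v j|) ^ 2) := by fun_prop
    exact hc.comp_aestronglyMeasurable (Lp.aestronglyMeasurable u)
  · rw [Real.norm_of_nonneg (sq_nonneg _)]
    exact sq_sum_abs_le (u t)

lemma switchingCost_nonneg {α : ℝ} (hα : 0 < α) (u : Control N T) : 0 ≤ switchingCost α u :=
  mul_nonneg (by positivity) (integral_nonneg fun _ => sq_nonneg _)

lemma switchingCost_le {α : ℝ} (hα : 0 < α) (u : Control N T) :
    switchingCost α u ≤ α / 2 * (N * ‖u‖ ^ 2) := by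
  rw [switchingCost, Lp_two_norm_sq, ← integral_const_mul (N : ℝ)]
  exact mul_le_mul_of_nonneg_left (integral_mono (integrable_sq_sum_abs u)
    ((Lp_two_integrable_norm_sq u).const_mul _) fun t => sq_sum_abs_le (u t)) (by positivity)

lemma convexOn_switchingCost {α : ℝ} (hα : 0 < α) :
    ConvexOn ℝ univ (switchingCost α : Control N T → ℝ) := by
  refine ⟨convex_univ, fun x _ y _ a b ha hb hab => ?_⟩
  have hle : ∫ t in Ioo (0 : ℝ) T, (∑ j, |(a • x + b • y : Control N T) t j|) ^ 2
      ≤ ∫ t in Ioo (0 : ℝ) T, (a * (∑ j, |x t j|) ^ 2 + b * (∑ j, |y t j|) ^ 2) := by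
    refine integral_mono_ae (integrable_sq_sum_abs _)
      (((integrable_sq_sum_abs x).const_mul a).add ((integrable_sq_sum_abs y).const_mul b)) ?_
    filter_upwards [Lp.coeFn_add (a • x) (b • y), Lp.coeFn_smul a x, Lp.coeFn_smul b y]
      with t h1 h2 h3
    rw [h1, Pi.add_apply, h2, h3]
    exact convexOn_sq_sum_abs.2 (mem_univ (x t)) (mem_univ (y t)) ha hb hab
  rw [integral_add ((integrable_sq_sum_abs x).const_mul a) ((integrable_sq_sum_abs y).const_mul b),
    integral_const_mul, integral_const_mul] at hle
  have h := mul_le_mul_of_nonneg_left hle (by positivity : 0 ≤ α / 2)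
  simp only [switchingCost, smul_eq_mul]
  linarith

lemma continuous_switchingCost {α : ℝ} (hα : 0 < α) :
    Continuous (switchingCost α : Control N T → ℝ) := by
  rw [← continuousOn_univ]
  -- A convex function bounded above near one point is continuous; here the bound holds on the unit
  -- ball.
  have htfae := (convexOn_switchingCost (N := N) (T := T) hα).continuousOn_tfae
    isOpen_univ univ_nonempty
  refine (htfae.out 1 3 :).2 ⟨0, mem_univ _, α / 2 * (N * 1), ?_⟩
  rw [eventually_map]
  filter_upwards [Metric.ball_mem_nhds (0 : Control N T) one_pos] with u hu
  refine (switchingCost_le hα u).trans ?_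
  have h : ‖u‖ ≤ 1 := (mem_ball_zero_iff.1 hu).le
  gcongr
  exact pow_le_one₀ (norm_nonneg u) h

end Lebesgue

end SwitchingControl

/-! ### The regularized optimality system. -/

open SwitchingControl

/-- Here `S` is an arbitrary continuous affine operator from controls to states; the solution
operator of the linear state equation is one. The first conjunct says that the proximal mapping
in the system is single-valued, the last that the system characterizes the minimizers. -/
theorem mainTheorem4 {n N : ℕ} {T : ℝ} (hT : 0 < T)
    {Ω ωobs : Set (EuclideanSpace ℝ (Fin n))} (hΩ : MeasurableSet Ω)
    (hω : MeasurableSet ωobs) (hsub : ωobs ⊆ Ω)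
    (S : SwitchingControl.Control N T →ᴬ[ℝ] SwitchingControl.SpaceTimeL2 T Ω)
    (yd : SwitchingControl.SpaceTimeL2 T ωobs) {α : ℝ} (hα : 0 < α) {γ : ℝ} (hγ : 0 < γ) :
    (∀ v : SwitchingControl.Control N T,
      ∃! w, w ∈ SwitchingControl.prox γ (SwitchingControl.switchingConj α) v) ∧
    (∃! x : SwitchingControl.Control N T × SwitchingControl.Control N T,
      SwitchingControl.SolvesRegularizedSystem S yd α γ x.1 x.2) ∧
    StrictConvexOn ℝ Set.univ (SwitchingControl.regularizedObjective S yd α γ) ∧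
    ∀ u : SwitchingControl.Control N T,
      IsMinOn (SwitchingControl.regularizedObjective S yd α γ) Set.univ u ↔
        ∃ p, SwitchingControl.SolvesRegularizedSystem S yd α γ u p := by
  obtain ⟨A, hA⟩ := exists_tracking_eq_half_norm_sq hω hsub S yd
  have hG := convexOn_switchingCost (N := N) (T := T) hα
  have hGc := continuous_switchingCost (N := N) (T := T) hα
  have hG0 := switchingCost_nonneg (N := N) (T := T) hα
  have hF : ConvexOn ℝ univ (tracking S yd) := hA ▸ convexOn_half_norm_sq_affine A yd
  have hFd : Differentiable ℝ (tracking S yd) := hA ▸ differentiable_half_norm_sq_affine A yd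
  have hF0 : ∀ u, 0 ≤ tracking S yd u := fun u => by rw [hA]; positivity
  have hstrong : StrongConvexOn univ γ (regularizedObjective S yd α γ) :=
    strongConvexOn_add_norm_sq (hF.add hG)
  have hstrict := hstrong.strictConvexOn hγ
  have hsys : ∀ u p, HasGradientAt (tracking S yd) (-p) u →
      (IsMinOn (regularizedObjective S yd α γ) univ u ↔
        u ∈ moreauYosida γ (switchingConj α) p) := fun u p hp => by
    -- `isMinOn_add_iff` is applied with `H = G + γ/2 ‖·‖²`.
    rw [switchingConj, mem_moreauYosida_fenchelConj_iff hγ hG hGc hG0, ← isMinOn_add_iff hp hF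
      ((strongConvexOn_add_norm_sq hG).strictConvexOn hγ).convexOn]
    simp only [← add_assoc]
    rfl
  have hiff : ∀ u, IsMinOn (regularizedObjective S yd α γ) univ u ↔
      ∃ p, SolvesRegularizedSystem S yd α γ u p := fun u => by
    constructor
    · intro hu
      have hgrad : HasGradientAt (tracking S yd) (-(-gradient (tracking S yd) u)) u := by
        rw [neg_neg]
        exact (hFd u).hasGradientAt
      exact ⟨_, hgrad, (hsys u _ hgrad).1 hu⟩
    · rintro ⟨p, hp, hu⟩
      exact (hsys u p hp).2 hu
  refine ⟨existsUnique_mem_prox_fenchelConj hγ hG hGc hG0, ?_, hstrict, hiff⟩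
  obtain ⟨u, hu⟩ := exists_isMinOn_of_strongConvexOn hγ hstrong
    ((hFd.continuous.add hGc).add (by fun_prop))
    ⟨0, by
      rintro _ ⟨x, rfl⟩
      exact add_nonneg (add_nonneg (hF0 x) (hG0 x)) (by positivity)⟩
  obtain ⟨p, hp⟩ := (hiff u).1 hu
  refine ⟨(u, p), hp, ?_⟩
  rintro ⟨v, q⟩ hq
  obtain rfl : v = u :=
    hstrict.eq_of_isMinOn ((hiff v).2 ⟨q, hq⟩) hu (mem_univ _) (mem_univ _)
  rw [Prod.mk.injEq]
  -- Uniqueness of the gradient at the common `u` fixes `p`.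
  exact ⟨rfl, neg_injective (hq.1.unique hp.1)⟩
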